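/- Let $K$ be $\mathbb{R}$ or $\mathbb{C}$. For a finite directed simple graph $G=(V,E)$ (no loops, no multiple edges) with $n=|V|$, $m=|E|$ and a distinguished vertex $1\in V$ (the input-output compartment), let $\Theta_G\subseteq K^{V\times V}$ be the space of all matrices $A=(a_{ij})$ with $a_{ij}=0$ whenever $i\neq j$ and $j\to i$ is not an edge of $G$ (the diagonal entries are unrestricted). Let $A_1$ be the matrix obtained from $A$ by deleting the row and the column of vertex $1$, and let $$c:\Theta_G\to K^{2n-1},\qquad c(A)=(c_1,\dots,c_n,d_1,\dots,d_{n-1}),$$ where $\det(\lambda I-A)=\lambda^n+c_1\lambda^{n-1}+\dots+c_n$ and $\det(\lambda I-A_1)=\lambda^{n-1}+d_1\lambda^{n-2}+\dots+d_{n-1}$. We say that $G$ has the expected dimension if the dimension of the image of $c$ (that is, of its Zariski closure) equals $m+1$. Suppose that $G$ is strongly connected and has the expected dimension. Let $s\ge 1$ and let $k,l\in V$ be vertices of $G$ ($k=l$ is allowed). Let $G'$ be obtained from $G$ by adding $s$ new vertices $n_1,\dots,n_s$ and the edges $k\to n_1$, $n_i\to n_{i+1}$ for $i=1,\dots,s-1$,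 and $n_s\to l$, with the same distinguished vertex $1$. Then $G'$ has the expected dimension. -/

import Mathlib

namespace CompartmentModel

/-- `G` is strongly connected: there is a directed path from any vertex to any other vertex. -/
def StronglyConnected {V : Type*} (G : Digraph V) : Prop :=
  ∀ u v : V, Relation.ReflTransGen G.Adj u v

/-- The number of edges of `G`. -/
noncomputable def numEdges {V : Type*} (G : Digraph V) : ℕ :=
  {e : V × V | G.Adj e.1 e.2}.ncard

/-- The parameter space of `G`: all matrices `A` whose off-diagonal entry `A i j` vanishes unless
`j → i` is an edge of `G`. The diagonal entries (which absorb the leaks) are free. -/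
def parameterSpace (K : Type*) [Field K] {V : Type*} (G : Digraph V) : Set (Matrix V V K) :=
  {A | ∀ i j : V, i ≠ j → ¬ G.Adj j i → A i j = 0}

/-- `A` with the row and the column of the vertex `r` deleted. -/
def deleteVertex {K V : Type*} (r : V) (A : Matrix V V K) :
    Matrix {v : V // v ≠ r} {v : V // v ≠ r} K :=
  A.submatrix Subtype.val Subtype.val

/-- The double characteristic polynomial map: `A` is sent to the non-leading coefficients of the
characteristic polynomials of `A` (there are `n` of them) and of `A` with the row and the column
of the input-output vertex `r` deleted (there are `n - 1` of them). -/
noncomputable def doubleCharpolyMap {K : Type*} [Field K] {V : Type*} [Fintype V] [DecidableEq V]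
    (r : V) (A : Matrix V V K) : Fin (Fintype.card V) ⊕ Fin (Fintype.card V - 1) → K :=
  Sum.elim (fun i => A.charpoly.coeff i) (fun i => (deleteVertex r A).charpoly.coeff i)

/-- The dimension of a subset `S` of affine space, i.e. the dimension of its Zariski closure:
the transcendence degree over `K` of the coordinate ring of the closure. -/
noncomputable def zariskiDim {K σ : Type*} [Field K] (S : Set (σ → K)) : Cardinal :=
  Algebra.trdeg K (MvPolynomial σ K ⧸ MvPolynomial.vanishingIdeal K S)

/-- `G` with input-output vertex `r` has the expected dimension (over `K`): the image of the
double characteristic polynomial map on the parameter space has dimension `m + 1`, where `m` is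
the number of edges. -/
def HasExpectedDimension (K : Type*) [Field K] {V : Type*} [Fintype V] [DecidableEq V]
    (G : Digraph V) (r : V) : Prop :=
  zariskiDim (doubleCharpolyMap r '' parameterSpace K G) = ((numEdges G + 1 : ℕ) : Cardinal)

/-- The edges of the graph obtained from `G` by adding a path
`k → n_0 → n_1 → ⋯ → n_{s-1} → l` through `s` new vertices. -/
def addPathAdj {V : Type*} (G : Digraph V) (s : ℕ) (k l : V) : V ⊕ Fin s → V ⊕ Fin s → Prop
  | .inl u, .inl v => G.Adj u v
  | .inl u, .inr j => u = k ∧ (j : ℕ) = 0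
  | .inr i, .inl v => (i : ℕ) + 1 = s ∧ v = l
  | .inr i, .inr j => (j : ℕ) = (i : ℕ) + 1

/-- The graph obtained from `G` by adding a path from `k` to `l` through `s` new vertices
(meaningful for `1 ≤ s`). -/
def addPath {V : Type*} (G : Digraph V) (s : ℕ) (k l : V) : Digraph (V ⊕ Fin s) where
  Adj := addPathAdj G s k l

end CompartmentModel

open Polynomial Matrix

namespace CompartmentModel

/-! ### Lower bounds on transcendence degree -/

section Trdeg

variable {K : Type*} [Field K]

/-! Over an infinite field the dimension of the image is the transcendence degree of the algebra
generated by the coefficients of `f = det(λ - A)` and `g = det(λ - A₁)` for the generic matrix `A`.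

Upper bound: conjugation by a diagonal matrix changes neither polynomial and can turn the entries on
a spanning tree rooted at `r` into 1. This leaves `n + m - (n - 1) = m + 1` parameters, so for a
strongly connected graph only the lower bound has to be proved (`hasExpectedDimension_iff`). The
path adds `s + 1` edges, so the dimension must grow by `s + 1`.

Lower bound: let `q` be the monic polynomial whose roots are the diagonal entries on the path, and
`e` the product of the path weights. The new pair is `F = q f - e h`, `G = q g - e h₁`, with `h`,
`h₁` the entries at `(k, l)` of the adjugates of `λ - A` and `λ - A₁` (for `h₁`, zero if `k` or `l`
is `r`). At `e = 0` the roots of `q` and the coefficients of `f`, `g` are integral over the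
coefficients of `q f`, `q g`, which gains `s`. Setting `e = 0` loses one more dimension unless it is
injective on the coefficient algebra. In that case `F` and `G` would keep a common factor, and its
first-order term in `e` at a root `p` of `q` forces `(h g - h₁ f)(p) = 0`
(`eval_eq_zero_of_injective`). As `p` is a free variable, `h g = h₁ f`. But Jacobi's identity
(`det_mul_adjugate_deleteVertex`) writes `h g - h₁ f` as the product of the adjugate entries at `(r,
l)` and `(k, r)`, and both are nonzero by strong connectivity (`exists_adjugate_ne_zero`). -/

theorem natCast_le_trdeg_iff {A : Type*} [CommRing A] [IsDomain A] [Algebra K A] (N : ℕ) :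
    (N : Cardinal) ≤ Algebra.trdeg K A ↔ ∃ y : Fin N → A, AlgebraicIndependent K y := by
  constructor
  · intro h
    obtain ⟨ι, x, hx⟩ := exists_isTranscendenceBasis' K A
    rw [← hx.cardinalMk_eq_trdeg] at h
    obtain ⟨j⟩ := Cardinal.lift_mk_le'.mp (by simpa using h :
      Cardinal.lift (Cardinal.mk (Fin N)) ≤ Cardinal.lift (Cardinal.mk ι))
    exact ⟨x ∘ j, hx.1.comp j j.injective⟩
  · rintro ⟨y, hy⟩
    simpa using hy.lift_cardinalMk_le_trdeg

theorem natCast_le_trdeg_of_injective {A B : Type*} [CommRing A] [Algebra K A]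
    [CommRing B] [Algebra K B] (φ : A →ₐ[K] B) (hφ : Function.Injective φ) {N : ℕ}
    (h : (N : Cardinal) ≤ Algebra.trdeg K A) : (N : Cardinal) ≤ Algebra.trdeg K B := by
  have h1 := lift_trdeg_le_of_injective φ hφ
  have h2 := (Cardinal.lift_le.mpr h).trans h1
  simpa using h2

theorem natCast_le_trdeg_of_surjective {A B : Type*} [CommRing A] [Algebra K A]
    [CommRing B] [Algebra K B] (φ : A →ₐ[K] B) (hφ : Function.Surjective φ) {N : ℕ}
    (h : (N : Cardinal) ≤ Algebra.trdeg K B) : (N : Cardinal) ≤ Algebra.trdeg K A := by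
  have h1 := lift_trdeg_le_of_surjective φ hφ
  have h2 := (Cardinal.lift_le.mpr h).trans h1
  simpa using h2

/-- The integral closure of `C` is algebraic over `C`, hence has the same transcendence degree; the
`y i` need not lie in `C` itself. -/
theorem natCast_le_trdeg_subalgebra {A : Type*} [CommRing A] [IsDomain A] [Algebra K A]
    (C : Subalgebra K A) {N : ℕ} (y : Fin N → A) (hy : AlgebraicIndependent K y)
    (hC : ∀ i, IsIntegral C (y i)) : (N : Cardinal) ≤ Algebra.trdeg K C := by
  let D := integralClosure C A
  have : FaithfulSMul C D := (faithfulSMul_iff_algebraMap_injective C D).mpr fun a b hab =>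
    Subtype.ext (congrArg (Subtype.val : D → A) hab)
  have h1 : Algebra.trdeg K C + Algebra.trdeg C D = Algebra.trdeg K D := trdeg_add_eq K C
  have h2 : Algebra.trdeg C D = 0 := trdeg_eq_zero
  rw [h2, add_zero] at h1
  rw [h1, natCast_le_trdeg_iff]
  refine ⟨fun i => ⟨y i, hC i⟩, ?_⟩
  exact AlgebraicIndependent.of_comp (D.restrictScalars K).val hy

/-- Lift an independent family along `φ` and adjoin a nonzero `z` in the kernel. In an algebraic
relation for `z` with nonzero constant term, `φ` kills that term, yet `φ` is injective on the
algebra generated by the lifts. -/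
theorem natCast_succ_le_trdeg {A B : Type*} [CommRing A] [IsDomain A] [Algebra K A]
    [CommRing B] [IsDomain B] [Algebra K B] (φ : A →ₐ[K] B) (hφ : Function.Surjective φ)
    (hinj : ¬ Function.Injective φ) {N : ℕ}
    (h : (N : Cardinal) ≤ Algebra.trdeg K B) : ((N + 1 : ℕ) : Cardinal) ≤ Algebra.trdeg K A := by
  obtain ⟨y, hy⟩ := (natCast_le_trdeg_iff N).mp h
  choose x hx using fun i => hφ (y i)
  obtain rfl : φ ∘ x = y := funext hx
  have hxi : AlgebraicIndependent K x := hy.of_comp φ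
  obtain ⟨z, hz, hz0⟩ : ∃ z, φ z = 0 ∧ z ≠ 0 := by
    by_contra! hc
    exact hinj ((injective_iff_map_eq_zero φ).mpr hc)
  have key : ∀ w ∈ Algebra.adjoin K (Set.range x), φ w = 0 → w = 0 := by
    intro w hw hw0
    rw [Algebra.adjoin_range_eq_range_aeval] at hw
    obtain ⟨P, rfl⟩ := hw
    have : MvPolynomial.aeval (φ ∘ x) P = 0 := by
      rw [← hw0]
      exact (MvPolynomial.comp_aeval_apply _ φ P).symm
    rw [(algebraicIndependent_iff.mp hy) P this, map_zero]
  have htr : Transcendental (Algebra.adjoin K (Set.range x)) z := by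
    intro halg
    obtain ⟨p, hp0, hp⟩ := halg.exists_nonzero_coeff_and_aeval_eq_zero
      (mem_nonZeroDivisors_of_ne_zero hz0)
    apply hp0
    apply Subtype.ext
    apply key _ (p.coeff 0).2
    have h1 := congrArg φ hp
    rw [← Polynomial.divX_mul_X_add p] at h1
    simp only [map_add, map_mul, aeval_X, hz, mul_zero, zero_add, aeval_C, map_zero] at h1
    exact h1
  have h2 := ((hxi.option_iff_transcendental z).mpr htr).lift_cardinalMk_le_trdeg
  simpa using h2

end Trdeg

/-! ### Persistence of a common root under deformation -/

section CommonRoot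

variable {K : Type*} [CommRing K]

/-- The algebra generated by the coefficients of two polynomials. -/
def coeffAlgebra (K : Type*) [CommRing K] {B : Type*} [CommRing B] [Algebra K B] (f g : B[X]) :
    Subalgebra K B :=
  Algebra.adjoin K (Set.range f.coeff ∪ Set.range g.coeff)

theorem map_coeffAlgebra {B B' : Type*} [CommRing B] [Algebra K B] [CommRing B'] [Algebra K B']
    (φ : B →ₐ[K] B') (f g : B[X]) :
    (coeffAlgebra K f g).map φ =
      coeffAlgebra K (f.map (φ : B →+* B')) (g.map (φ : B →+* B')) := by
  rw [coeffAlgebra, coeffAlgebra, AlgHom.map_adjoin, Set.image_union, ← Set.range_comp,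
    ← Set.range_comp]
  congr 3 <;> · ext i; simp

theorem exists_map_eq_left {B : Type*} [CommRing B] [Algebra K B] (f g : B[X]) :
    ∃ p : (coeffAlgebra K f g)[X], p.map (algebraMap (coeffAlgebra K f g) B) = f := by
  have := (Polynomial.mem_lifts (f := algebraMap (coeffAlgebra K f g) B) f).mp
    ((Polynomial.lifts_iff_coeff_lifts f).mpr fun n =>
      ⟨⟨f.coeff n, Algebra.subset_adjoin (Or.inl ⟨n, rfl⟩)⟩, rfl⟩)
  exact this

theorem exists_map_eq_right {B : Type*} [CommRing B] [Algebra K B] (f g : B[X]) :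
    ∃ p : (coeffAlgebra K f g)[X], p.map (algebraMap (coeffAlgebra K f g) B) = g := by
  have := (Polynomial.mem_lifts (f := algebraMap (coeffAlgebra K f g) B) g).mp
    ((Polynomial.lifts_iff_coeff_lifts g).mpr fun n =>
      ⟨⟨g.coeff n, Algebra.subset_adjoin (Or.inr ⟨n, rfl⟩)⟩, rfl⟩)
  exact this

/-- If two polynomials over `A` have a common root in a domain containing `A`, then up to
multiplication by a nonzero constant of `A` they have a common divisor with that root. -/
theorem exists_common_divisor {A R : Type*} [CommRing A] [IsDomain A] [CommRing R] [IsDomain R]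
    (π : A →+* R) (hπ : Function.Injective π) (F G : A[X]) (hF : F ≠ 0) (p : R)
    (hFp : F.eval₂ π p = 0) (hGp : G.eval₂ π p = 0) :
    ∃ (c : A) (P V W : A[X]), c ≠ 0 ∧ P ≠ 0 ∧ P.eval₂ π p = 0 ∧ C c * F = P * V ∧
      C c * G = P * W := by
  let k := FractionRing A
  let L := FractionRing R
  let φ : k →+* L := IsLocalization.map L (T := nonZeroDivisors R) π
    (nonZeroDivisors_le_comap_nonZeroDivisors_of_injective π hπ)
  let : Algebra k L := φ.toAlgebra
  have hcomp : (algebraMap k L).comp (algebraMap A k) = (algebraMap R L).comp π := by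
    change φ.comp _ = _
    exact IsLocalization.map_comp _
  have hroot : ∀ H : A[X], aeval (algebraMap R L p) (H.map (algebraMap A k)) =
      algebraMap R L (H.eval₂ π p) := by
    intro H
    rw [aeval_def, eval₂_map, hcomp, hom_eval₂]
  have hk : Function.Injective (algebraMap A k) := IsFractionRing.injective A k
  -- The minimal polynomial of `p` over the fraction field of `A` divides both polynomials there;
  -- clearing denominators accounts for the constant `c`.
  set m := minpoly k (algebraMap R L p)
  have hint : IsIntegral k (algebraMap R L p) := by
    refine (isAlgebraic_iff_isIntegral).mp ⟨F.map (algebraMap A k), ?_, ?_⟩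
    · rwa [Ne, Polynomial.map_eq_zero_iff hk]
    · rw [hroot, hFp, map_zero]
  have hdF : m ∣ F.map (algebraMap A k) := minpoly.dvd _ _ (by rw [hroot, hFp, map_zero])
  have hdG : m ∣ G.map (algebraMap A k) := minpoly.dvd _ _ (by rw [hroot, hGp, map_zero])
  obtain ⟨v, hv⟩ := hdF
  obtain ⟨w, hw⟩ := hdG
  have clear : ∀ u : k[X], ∃ (b : A) (U : A[X]), b ≠ 0 ∧
      U.map (algebraMap A k) = C (algebraMap A k b) * u := by
    intro u
    obtain ⟨b, hb, hb'⟩ := IsLocalization.integerNormalization_spec (nonZeroDivisors A) u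
    refine ⟨b, _, nonZeroDivisors.ne_zero hb, hb'.trans ?_⟩
    rw [← algebraMap_smul k b u, smul_eq_C_mul]
  obtain ⟨b₁, P, hb₁, hP⟩ := clear m
  obtain ⟨b₂, V, hb₂, hV⟩ := clear v
  obtain ⟨b₃, W, hb₃, hW⟩ := clear w
  have hm0 : m ≠ 0 := minpoly.ne_zero hint
  refine ⟨b₁ * b₂ * b₃, P, C b₃ * V, C b₂ * W, by simp [hb₁, hb₂, hb₃], ?_, ?_, ?_, ?_⟩
  · rintro rfl
    rw [Polynomial.map_zero, eq_comm, mul_eq_zero, C_eq_zero, map_eq_zero_iff _ hk] at hP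
    exact hP.elim hb₁ hm0
  · apply IsFractionRing.injective R L
    rw [← hroot, hP, map_mul, minpoly.aeval, mul_zero, map_zero]
  · apply Polynomial.map_injective _ hk
    simp only [Polynomial.map_mul, map_C, map_mul, hP, hV, hv]
    ring
  · apply Polynomial.map_injective _ hk
    simp only [Polynomial.map_mul, map_C, map_mul, hP, hW, hw]
    ring

/-- If `q` has the root `p` and the coefficients of `q f - e h` and `q g - e h₁` (where `e` is a
variable) satisfy all algebraic relations between the coefficients of `q f` and `q g`, then `p` is
a root of `h g - h₁ f`. -/
theorem eval_eq_zero_of_injective {R : Type*} [CommRing R] [IsDomain R] [Algebra K R]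
    (q f g h h₁ : R[X]) (hq : q ≠ 0) (hf : f ≠ 0) (p : R) (hp : q.eval p = 0)
    (F G : R[X][X])
    (hF : F = (q * f).map C - C X * h.map C) (hG : G = (q * g).map C - C X * h₁.map C)
    (hinj : Function.Injective
      ((constantCoeff : R[X] →+* R).comp (algebraMap (coeffAlgebra K F G) R[X]))) :
    (h * g - h₁ * f).eval p = 0 := by
  set A := coeffAlgebra K F G
  set ι := algebraMap A R[X]
  set π := (constantCoeff : R[X] →+* R).comp ι
  have hred : ∀ u v : R[X], (u.map C - C X * v.map C).map (constantCoeff : R[X] →+* R) = u := by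
    intro u v
    ext i
    simp [coeff_map]
  obtain ⟨FA, hFA⟩ := exists_map_eq_left (K := K) F G
  obtain ⟨GA, hGA⟩ := exists_map_eq_right (K := K) F G
  have hFA0 : FA.map π = q * f := by
    rw [← Polynomial.map_map, hFA, hF, hred]
  have hGA0 : GA.map π = q * g := by
    rw [← Polynomial.map_map, hGA, hG, hred]
  obtain ⟨c, P, V, W, hc, hP, hPp, hV, hW⟩ := exists_common_divisor π hinj FA GA
    (by rintro rfl; rw [Polynomial.map_zero, eq_comm] at hFA0; exact (mul_ne_zero hq hf) hFA0) p
    (by rw [← eval_map, hFA0, eval_mul, hp, zero_mul])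
    (by rw [← eval_map, hGA0, eval_mul, hp, zero_mul])
  have hev : ∀ U : A[X], constantCoeff ((U.map ι).eval (C p)) = (U.map π).eval p := by
    intro U
    rw [eval_map, hom_eval₂, eval_map]
    simp [π]
  have hmap : ∀ u v : R[X], ((u.map C - C X * v.map C).eval (C p) : R[X]) =
      C (u.eval p) - X * C (v.eval p) := by
    intro u v
    simp [eval_map, eval₂_at_apply]
  -- the common divisor, evaluated at `p`, is divisible by the variable
  obtain ⟨t, ht⟩ : (X : R[X]) ∣ (P.map ι).eval (C p) := by
    rw [X_dvd_iff, ← constantCoeff_apply, hev, eval_map, hPp]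
  -- Since `q` vanishes at `p`, both sides of `c H = P U` at `p` are multiples of the variable;
  -- dividing by it and then setting it to zero compares first-order terms.
  have cancel : ∀ (H U : A[X]) (u v : R[X]), H.map ι = (q * u).map C - C X * v.map C →
      C c * H = P * U → -(π c * v.eval p) = t.coeff 0 * (U.map π).eval p := by
    intro H U u v hH hU
    have h1 := congrArg (fun z : A[X] => (z.map ι).eval (C p)) hU
    rw [Polynomial.map_mul, Polynomial.map_mul, hH, map_C, eval_mul, eval_mul, hmap, ht, eval_mul,
      eval_C, hp, zero_mul, map_zero, zero_sub] at h1
    have h2 : -(ι c * C (v.eval p)) = t * (U.map ι).eval (C p) := by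
      apply mul_left_cancel₀ (X_ne_zero (R := R))
      linear_combination h1
    have h3 := congrArg constantCoeff h2
    rw [map_neg, map_mul, map_mul, hev] at h3
    simpa [π] using h3
  have e1 := cancel FA V f h (by rw [hFA, hF]) hV
  have e2 := cancel GA W g h₁ (by rw [hGA, hG]) hW
  -- The zeroth-order terms: the cofactors of `P` are in the ratio of `f` to `g`.
  have e3 : V.map π * g = W.map π * f := by
    have hP0 : P.map π ≠ 0 := by rwa [Ne, Polynomial.map_eq_zero_iff hinj]
    have h1 := congrArg (Polynomial.map π) hV
    have h2 := congrArg (Polynomial.map π) hW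
    simp only [Polynomial.map_mul, hFA0, hGA0] at h1 h2
    apply mul_left_cancel₀ hP0
    linear_combination f * h2 - g * h1
  have e4 := congrArg (eval p) e3
  simp only [eval_mul] at e4
  have hc0 : π c ≠ 0 := by rwa [Ne, map_eq_zero_iff π hinj]
  apply mul_left_cancel₀ hc0
  simp only [eval_sub, eval_mul]
  linear_combination -(g.eval p) * e1 + f.eval p * e2 - t.coeff 0 * e4

end CommonRoot

/-! ### Growth of the coefficient algebra -/

section Path

variable {K : Type*} [Field K]

/-- Roots of a monic polynomial, and coefficients of its monic divisors, are integral over its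
coefficients. So the `s` variables and the old independent family are all integral over the new
algebra. -/
theorem natCast_le_trdeg_coeffAlgebra_mul {R : Type*} [CommRing R] [IsDomain R] [Algebra K R]
    {f g : R[X]} (hf : f.Monic) (hg : g.Monic) {N s : ℕ}
    (hN : (N : Cardinal) ≤ Algebra.trdeg K (coeffAlgebra K f g)) :
    ((N + s : ℕ) : Cardinal) ≤ Algebra.trdeg K (coeffAlgebra K
      ((∏ i : Fin s, (X - C (MvPolynomial.X i : MvPolynomial (Fin s) R))) * f.map MvPolynomial.C)
      ((∏ i : Fin s, (X - C (MvPolynomial.X i : MvPolynomial (Fin s) R))) *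
        g.map MvPolynomial.C)) := by
  set q : (MvPolynomial (Fin s) R)[X] := ∏ i : Fin s, (X - C (MvPolynomial.X i)) with hq
  have hqm : q.Monic := monic_prod_of_monic _ _ fun i _ => monic_X_sub_C _
  set D := coeffAlgebra K (q * f.map MvPolynomial.C) (q * g.map MvPolynomial.C)
  have hDinj : Function.Injective (algebraMap D (MvPolynomial (Fin s) R)) := Subtype.val_injective
  obtain ⟨F, hF⟩ := exists_map_eq_left (K := K)
    (q * f.map MvPolynomial.C) (q * g.map MvPolynomial.C)
  obtain ⟨G, hG⟩ := exists_map_eq_right (K := K)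
    (q * f.map MvPolynomial.C) (q * g.map MvPolynomial.C)
  have hFm : F.Monic := by
    apply monic_of_injective hDinj
    rw [hF]
    exact hqm.mul (hf.map _)
  have hGm : G.Monic := by
    apply monic_of_injective hDinj
    rw [hG]
    exact hqm.mul (hg.map _)
  obtain ⟨y, hy⟩ := (natCast_le_trdeg_iff N).mp hN
  have hy' : AlgebraicIndependent K fun i => (y i : R) :=
    hy.map' (f := (coeffAlgebra K f g).val) Subtype.val_injective
  have hx : AlgebraicIndependent K (Sum.elim
      (MvPolynomial.X : Fin s → MvPolynomial (Fin s) R) (algebraMap R _ ∘ fun i => (y i : R))) :=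
    hy'.sumElim_comp (MvPolynomial.algebraicIndependent_X (Fin s) R)
  have hx' := hx.comp (finSumFinEquiv.symm ∘ finCongr (add_comm N s))
    (finSumFinEquiv.symm.injective.comp (finCongr (add_comm N s)).injective)
  apply natCast_le_trdeg_subalgebra _ _ hx'
  have hle : coeffAlgebra K f g ≤ ((integralClosure D (MvPolynomial (Fin s) R)).restrictScalars
      K).comap (IsScalarTower.toAlgHom K R (MvPolynomial (Fin s) R)) := by
    refine Algebra.adjoin_le ?_
    rintro _ (⟨i, rfl⟩ | ⟨i, rfl⟩)
    · have := isIntegral_coeff_of_dvd F (f.map MvPolynomial.C) hFm (hf.map _)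
        (by rw [hF]; exact dvd_mul_left _ _) i
      rwa [coeff_map] at this
    · have := isIntegral_coeff_of_dvd G (g.map MvPolynomial.C) hGm (hg.map _)
        (by rw [hG]; exact dvd_mul_left _ _) i
      rwa [coeff_map] at this
  have hall : ∀ j, IsIntegral D (Sum.elim
      (MvPolynomial.X : Fin s → MvPolynomial (Fin s) R)
      (algebraMap R _ ∘ fun i => (y i : R)) j) := by
    rintro (i | i)
    · refine ⟨F, hFm, ?_⟩
      rw [← eval_map, hF, eval_mul, hq, eval_prod, Finset.prod_eq_zero (Finset.mem_univ i),
        zero_mul]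
      simp
    · exact hle (y i).2
  exact fun i => hall _

/-- Passing from `(f, g)` to `(q f - e h, q g - e h₁)`, where `e` and the `s ≥ 1` roots of the
monic polynomial `q` are new variables, increases the transcendence degree of the algebra of
coefficients by at least `s + 1` unless `h g = h₁ f`. -/
theorem natCast_le_trdeg_coeffAlgebra_path {R : Type*} [CommRing R] [IsDomain R] [Algebra K R]
    {f g h h₁ : R[X]} (hf : f.Monic) (hg : g.Monic) (hne : h * g - h₁ * f ≠ 0) {N s : ℕ}
    (hs : 1 ≤ s) (hN : (N : Cardinal) ≤ Algebra.trdeg K (coeffAlgebra K f g))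
    (q : (MvPolynomial (Fin s) R)[X]) (hq : q = ∏ i : Fin s, (X - C (MvPolynomial.X i)))
    (F G : (MvPolynomial (Fin s) R)[X][X])
    (hF : F = (q * f.map MvPolynomial.C).map C - C X * (h.map MvPolynomial.C).map C)
    (hG : G = (q * g.map MvPolynomial.C).map C - C X * (h₁.map MvPolynomial.C).map C) :
    ((N + s + 1 : ℕ) : Cardinal) ≤ Algebra.trdeg K (coeffAlgebra K F G) := by
  let S := MvPolynomial (Fin s) R
  have hqm : q.Monic := hq ▸ monic_prod_of_monic _ _ fun i _ => monic_X_sub_C _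
  -- The specialization `e = 0`, which sends the pair to `q f`, `q g`.
  let ev : S[X] →ₐ[K] S := (aeval (0 : S) : S[X] →ₐ[S] S).restrictScalars K
  have hred : ∀ u v : S[X], (u.map C - C X * v.map C).map (ev : S[X] →+* S) = u := by
    intro u v
    ext i
    simp [coeff_map, ev]
  let A := coeffAlgebra K F G
  have hmap : A.map ev =
      coeffAlgebra K (q * f.map MvPolynomial.C) (q * g.map MvPolynomial.C) := by
    rw [map_coeffAlgebra, hF, hG, hred, hred]
  let φ : A →ₐ[K] A.map ev := (ev.comp A.val).codRestrict (A.map ev) fun x => ⟨x, x.2, rfl⟩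
  have hφ : Function.Surjective φ := by
    rintro ⟨_, x, hx, rfl⟩
    exact ⟨⟨x, hx⟩, rfl⟩
  apply natCast_succ_le_trdeg φ hφ
  · intro hinj
    have hroot := eval_eq_zero_of_injective (K := K) q (f.map MvPolynomial.C)
      (g.map MvPolynomial.C) (h.map MvPolynomial.C) (h₁.map MvPolynomial.C) hqm.ne_zero
      (hf.map _).ne_zero (MvPolynomial.X ⟨0, hs⟩)
      (by rw [hq, eval_prod, Finset.prod_eq_zero (Finset.mem_univ (⟨0, hs⟩ : Fin s))]; simp)
      F G hF hG (by
        intro a b hab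
        apply hinj
        apply Subtype.ext
        change ev (a : S[X]) = ev (b : S[X])
        have hev : ∀ z : S[X], ev z = constantCoeff z := fun z => by
          simp [ev, coeff_zero_eq_aeval_zero]
        rw [hev, hev]
        exact hab)
    apply hne
    rw [← Polynomial.map_mul, ← Polynomial.map_mul, ← Polynomial.map_sub, eval_map] at hroot
    -- A root of `q` is a free variable over `R`, so a polynomial over `R` vanishing there is zero.
    -- This is where `1 ≤ s` provides a root.
    have htr : Transcendental R (MvPolynomial.X ⟨0, hs⟩ : S) := MvPolynomial.transcendental_X R _
    exact (transcendental_iff.mp htr) _ hroot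
  · rw [hmap, hq]
    exact natCast_le_trdeg_coeffAlgebra_mul hf hg hN

end Path

/-! ### Determinant of a matrix with an attached path -/

section PathMatrix

/-- The matrix of a path with `s` vertices: diagonal `z`, subdiagonal entries `c`. -/
def pathMatrix {L : Type*} [Zero L] {s : ℕ} (c : L) (z : Fin s → L) : Matrix (Fin s) (Fin s) L :=
  Matrix.of fun i j => if i = j then z i else if (i : ℕ) = j + 1 then c else 0

/-- The matrix `A` with a path attached to it, which is entered with weights `b` and left with
weights `a`; the diagonal entries of the path are `z`, its edges have weight `c`. -/
def attachPath {L U : Type*} [Zero L] {s : ℕ} (A : Matrix U U L) (a b : U → L) (c : L)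
    (z : Fin s → L) : Matrix (U ⊕ Fin s) (U ⊕ Fin s) L :=
  Matrix.fromBlocks A (Matrix.of fun u j => if (j : ℕ) + 1 = s then a u else 0)
    (Matrix.of fun i v => if (i : ℕ) = 0 then b v else 0) (pathMatrix c z)

theorem det_add_vecMulVec {L U : Type*} [Field L] [Fintype U] [DecidableEq U]
    (N : Matrix U U L) (hN : N.det ≠ 0) (a b : U → L) :
    (N + vecMulVec a b).det = N.det + b ⬝ᵥ (N.adjugate *ᵥ a) := by
  have h := det_add_replicateCol_mul_replicateRow (ι := Unit) (A := N) hN.isUnit a b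
  have h1 : replicateCol Unit a * replicateRow Unit b = vecMulVec a b := by
    ext i j
    simp [Matrix.mul_apply, vecMulVec_apply]
  rw [h1] at h
  have h2 : (replicateRow Unit b * N⁻¹ * replicateCol Unit a) default default =
      Ring.inverse N.det * (b ⬝ᵥ (N.adjugate *ᵥ a)) := by
    rw [Matrix.inv_def, Matrix.mul_assoc, Matrix.smul_mul, Matrix.mul_smul, Matrix.smul_apply,
      smul_eq_mul]
    rfl
  rw [h, Matrix.det_unique (1 + _), Matrix.add_apply, Matrix.one_apply_eq, h2, mul_add, mul_one,
    ← mul_assoc, Ring.mul_inverse_cancel _ hN.isUnit, one_mul]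

theorem det_pathMatrix {L : Type*} [CommRing L] {s : ℕ} (c : L) (z : Fin s → L) :
    (pathMatrix c z).det = ∏ i, z i := by
  rw [Matrix.det_of_isLowerTriangular]
  · simp [pathMatrix]
  · intro i j hij
    have hij : i < j := hij
    have h1 : (i : ℕ) < j := hij
    simp only [pathMatrix, of_apply]
    rw [if_neg hij.ne, if_neg (by omega)]

/-- The solution of the bidiagonal system of a path. -/
theorem pathMatrix_mulVec {L : Type*} [Field L] {s : ℕ} (z : Fin s → L) (hz : ∀ i, z i ≠ 0)
    (i : Fin s) :
    (pathMatrix (-1) z *ᵥ fun j => (∏ t ∈ Finset.Iic j, z t)⁻¹) i =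
      if (i : ℕ) = 0 then 1 else 0 := by
  have hz0 : ∀ S : Finset (Fin s), ∏ t ∈ S, z t ≠ 0 := fun S =>
    Finset.prod_ne_zero_iff.mpr fun i _ => hz i
  rw [Matrix.mulVec, dotProduct]
  split_ifs with hi
  · rw [Finset.sum_eq_single i]
    · have : Finset.Iic i = {i} := by
        ext j
        simp only [Finset.mem_Iic, Finset.mem_singleton, Fin.le_def, Fin.ext_iff]
        omega
      simp [pathMatrix, this, hz i]
    · intro j _ hj
      simp [pathMatrix, hj.symm, hi]
    · simp
  · have hi' : (i : ℕ) - 1 < s := by omega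
    rw [Finset.sum_eq_add (⟨(i : ℕ) - 1, hi'⟩ : Fin s) i]
    · have h1 : Finset.Iic i = insert i (Finset.Iic ⟨(i : ℕ) - 1, hi'⟩) := by
        ext j
        simp only [Finset.mem_Iic, Finset.mem_insert, Fin.le_def, Fin.ext_iff]
        omega
      rw [h1, Finset.prod_insert (by simp [Fin.le_def]; omega)]
      simp only [pathMatrix, of_apply, if_true, Fin.ext_iff]
      rw [if_neg (by omega), if_pos (by omega)]
      have := hz0 (Finset.Iic ⟨(i : ℕ) - 1, hi'⟩)
      have := hz i
      field_simp
      ring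
    · intro h
      have := congrArg Fin.val h
      simp at this
      omega
    · intro j _ hj
      simp only [Ne, Fin.ext_iff] at hj
      simp only [pathMatrix, of_apply, Fin.ext_iff]
      rw [if_neg (by omega), if_neg (by omega), zero_mul]
    · simp
    · simp

/-- A unipotent column operation built from the solution `x` of the path system clears the lower
left block. The exit column sees only the last coordinate of `x`, the inverse of `∏ z i`, so `N`
undergoes a rank-one update. -/
theorem det_attachPath {L U : Type*} [Field L] [Fintype U] [DecidableEq U] {s : ℕ} (hs : 1 ≤ s)
    (N : Matrix U U L) (hN : N.det ≠ 0) (a b : U → L) (z : Fin s → L) (hz : ∀ i, z i ≠ 0) :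
    (attachPath N (-a) (-b) (-1) z).det =
      (∏ i, z i) * N.det - b ⬝ᵥ (N.adjugate *ᵥ a) := by
  set x : Fin s → L := fun j => (∏ t ∈ Finset.Iic j, z t)⁻¹ with hx
  have hlast : x ⟨s - 1, by omega⟩ = (∏ i, z i)⁻¹ := by
    have : Finset.Iic (⟨s - 1, by omega⟩ : Fin s) = Finset.univ := by
      ext i
      simp only [Finset.mem_Iic, Finset.mem_univ, iff_true, Fin.le_def]
      omega
    simp only [hx, this]
  have hprod : attachPath N (-a) (-b) (-1) z * Matrix.fromBlocks 1 0 (vecMulVec x b) 1 =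
      Matrix.fromBlocks (N + vecMulVec (-(∏ i, z i)⁻¹ • a) b)
        (Matrix.of fun u (j : Fin s) => if (j : ℕ) + 1 = s then (-a) u else 0) 0 (pathMatrix (-1) z) := by
    rw [attachPath, Matrix.fromBlocks_multiply]
    simp only [Matrix.mul_one, Matrix.mul_zero, zero_add]
    congr 1
    · congr 1
      ext u v
      rw [Matrix.mul_apply, Finset.sum_eq_single (⟨s - 1, by omega⟩ : Fin s)]
      · rw [of_apply, if_pos (by simp; omega), vecMulVec_apply, hlast, vecMulVec_apply]
        simp only [Pi.neg_apply, Pi.smul_apply, smul_eq_mul]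
        ring
      · intro j _ hj
        rw [of_apply, if_neg, zero_mul]
        intro h
        exact hj (Fin.ext (by simp; omega))
      · simp
    · ext i v
      rw [Matrix.mul_vecMulVec]
      simp only [Matrix.add_apply, of_apply, vecMulVec_apply, pathMatrix_mulVec z hz, hx,
        Matrix.zero_apply, Pi.neg_apply]
      split_ifs <;> simp
  have h := congrArg Matrix.det hprod
  have hz0 : ∏ i, z i ≠ 0 := Finset.prod_ne_zero_iff.mpr fun i _ => hz i
  rw [Matrix.det_mul, Matrix.det_fromBlocks_zero₁₂, Matrix.det_fromBlocks_zero₂₁, det_pathMatrix,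
    det_one, det_one, mul_one, mul_one, det_add_vecMulVec N hN, mulVec_smul, dotProduct_smul,
    smul_eq_mul] at h
  rw [h]
  field_simp
  ring

/-- The characteristic polynomial of a matrix with a path attached to it. -/
theorem charpoly_attachPath {B U : Type*} [CommRing B] [IsDomain B] [Fintype U] [DecidableEq U]
    {s : ℕ} (hs : 1 ≤ s) (A : Matrix U U B) (a b : U → B) (p : Fin s → B) :
    (attachPath A a b 1 p).charpoly = (∏ i, (X - C (p i))) * A.charpoly -
      (C ∘ b) ⬝ᵥ (A.charmatrix.adjugate *ᵥ (C ∘ a)) := by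
  -- The determinant formula needs inverses, but its final form has no denominators and so descends
  -- from the fraction field.
  let L := FractionRing B[X]
  let ι := algebraMap B[X] L
  have hι : Function.Injective ι := IsFractionRing.injective B[X] L
  have hcm : (attachPath A a b 1 p).charmatrix =
      attachPath A.charmatrix (-(C ∘ a)) (-(C ∘ b)) (-1) (fun i => X - C (p i)) := by
    ext1 i j
    rcases i with i | i <;> rcases j with j | j
    · simp [attachPath, charmatrix_apply, Matrix.diagonal_apply]
    · simp only [attachPath, charmatrix_apply_ne _ _ _ Sum.inl_ne_inr, fromBlocks_apply₁₂, of_apply]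
      split_ifs <;> simp
    · simp only [attachPath, charmatrix_apply_ne _ _ _ Sum.inr_ne_inl, fromBlocks_apply₂₁, of_apply]
      split_ifs <;> simp
    · by_cases hij : i = j
      · subst hij
        simp [attachPath, pathMatrix]
      · simp only [attachPath, fromBlocks_apply₂₂, pathMatrix, of_apply,
          charmatrix_apply_ne _ _ _ (Sum.inr_injective.ne hij), hij, if_false]
        split_ifs <;> simp
  have hmap : (attachPath A.charmatrix (-(C ∘ a)) (-(C ∘ b)) (-1) (fun i => X - C (p i))).map ι =
      attachPath (A.charmatrix.map ι) (-(ι ∘ C ∘ a)) (-(ι ∘ C ∘ b)) (-1)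
        (fun i => ι (X - C (p i))) := by
    ext1 i j
    rcases i with i | i <;> rcases j with j | j <;>
      simp [attachPath, pathMatrix, apply_ite ι]
  apply hι
  rw [Matrix.charpoly, hcm, RingHom.map_det, RingHom.mapMatrix_apply, hmap,
    det_attachPath hs _ _ _ _ _ fun i => ?_, map_sub, map_mul, map_prod, Matrix.charpoly,
    RingHom.map_det, RingHom.mapMatrix_apply, RingHom.map_dotProduct]
  · have hadj : ι ∘ (A.charmatrix.adjugate *ᵥ (C ∘ a)) =
        (A.charmatrix.map ι).adjugate *ᵥ (ι ∘ C ∘ a) := by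
      ext i
      rw [Function.comp_apply, RingHom.map_mulVec, ← RingHom.mapMatrix_apply, RingHom.map_adjugate]
      rfl
    rw [hadj]
  · rw [← RingHom.mapMatrix_apply, ← RingHom.map_det, map_ne_zero_iff _ hι]
    exact A.charpoly_monic.ne_zero
  · rw [map_ne_zero_iff _ hι]
    exact X_sub_C_ne_zero _

end PathMatrix

/-! ### Jacobi's identity -/

section Adjugate

variable {V : Type*} [Fintype V] [DecidableEq V]

theorem charmatrix_deleteVertex {B : Type*} [CommRing B] (r : V) (M : Matrix V V B) :
    (deleteVertex r M).charmatrix = deleteVertex r M.charmatrix := by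
  ext1 i j
  simp [deleteVertex, charmatrix_apply, Matrix.diagonal_apply, Subtype.ext_iff]

theorem adjugate_apply_self {B : Type*} [CommRing B] (N : Matrix V V B) (r : V) :
    N.adjugate r r = (deleteVertex r N).det := by
  rw [Matrix.adjugate_apply, Matrix.twoBlockTriangular_det _ (fun v => v ≠ r)]
  · have h1 : toSquareBlockProp (N.updateRow r (Pi.single r 1)) (fun v => v ≠ r) =
        deleteVertex r N := by
      ext i j
      simp [toSquareBlockProp, deleteVertex, Matrix.updateRow_ne i.2]
    have h2 : toSquareBlockProp (N.updateRow r (Pi.single r 1)) (fun v => ¬ v ≠ r) = 1 := by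
      ext ⟨i, hi⟩ ⟨j, hj⟩
      obtain rfl := not_not.mp hi
      obtain rfl := not_not.mp hj
      simp [toSquareBlockProp]
    rw [h1, h2, det_one, mul_one]
  · intro i hi j hj
    obtain rfl := not_not.mp hi
    simp [hj]

theorem dotProduct_subtype_ne {B : Type*} [CommRing B] (r : V) (b y : V → B) (hy : y r = 0) :
    (b ∘ (Subtype.val : {v // v ≠ r} → V)) ⬝ᵥ (y ∘ Subtype.val) = b ⬝ᵥ y := by
  have h1 := Finset.sum_subtype (F := inferInstance) (Finset.univ.filter fun v => v ≠ r) (p := fun v => v ≠ r)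
    (by simp) (fun v => b v * y v)
  refine h1.symm.trans (Finset.sum_subset (Finset.subset_univ _) fun v _ hv => ?_)
  have : v = r := by simpa using hv
  rw [this, hy, mul_zero]

/-- A bordered form of Jacobi's identity for the minors of the adjugate. -/
theorem det_mul_adjugate_deleteVertex {B : Type*} [CommRing B] [IsDomain B] (N : Matrix V V B)
    (r : V) (hr : (deleteVertex r N).det ≠ 0) (a b : V → B) :
    (b ⬝ᵥ (N.adjugate *ᵥ a)) * (deleteVertex r N).det -
      ((b ∘ Subtype.val) ⬝ᵥ ((deleteVertex r N).adjugate *ᵥ (a ∘ Subtype.val))) * N.det =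
    (N.adjugate *ᵥ a) r * (b ᵥ* N.adjugate) r := by
  set w := N.adjugate *ᵥ a with hw
  set z := N.adjugate *ᵥ Pi.single r 1 with hz
  -- This combination vanishes at `r`, so its restriction solves a system for the deleted matrix,
  -- whose right-hand side is a multiple of `a` away from `r`.
  set y := z r • w - w r • z with hy
  have hzr : z r = (deleteVertex r N).det := by
    rw [← adjugate_apply_self, hz, mulVec_single_one]
    rfl
  have hyr : y r = 0 := by simp [hy, mul_comm]
  have hNy : N *ᵥ y = N.det • (z r • a - w r • Pi.single r 1) := by
    rw [hy, mulVec_sub, mulVec_smul, mulVec_smul, hw, hz, mulVec_mulVec, mulVec_mulVec,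
      mul_adjugate, smul_mulVec, smul_mulVec, one_mulVec, one_mulVec, smul_sub]
    congr 1 <;> exact smul_comm _ _ _
  have hN1 : deleteVertex r N *ᵥ (y ∘ Subtype.val) =
      (N.det * (deleteVertex r N).det) • (a ∘ Subtype.val) := by
    ext i
    have h1 : (deleteVertex r N *ᵥ (y ∘ Subtype.val)) i = (N *ᵥ y) i :=
      dotProduct_subtype_ne r (N i) y hyr
    rw [h1, hNy]
    simp [hzr, i.2, mul_assoc]
  have hy1 : y ∘ Subtype.val =
      N.det • ((deleteVertex r N).adjugate *ᵥ (a ∘ (Subtype.val : {v // v ≠ r} → V))) := by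
    have h1 := congrArg ((deleteVertex r N).adjugate *ᵥ ·) hN1
    simp only [mulVec_mulVec, adjugate_mul, smul_mulVec, one_mulVec, mulVec_smul] at h1
    rw [mul_comm, mul_smul] at h1
    exact smul_right_injective _ hr h1
  have h2 := dotProduct_subtype_ne r b y hyr
  rw [hy1, dotProduct_smul, hy, dotProduct_sub, dotProduct_smul, dotProduct_smul, hzr] at h2
  have h3 : b ⬝ᵥ z = (b ᵥ* N.adjugate) r := by
    rw [hz, dotProduct_mulVec, dotProduct_single_one]
  rw [h3] at h2
  simp only [smul_eq_mul] at h2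
  linear_combination -h2

end Adjugate

/-! ### Spanning trees and nonvanishing adjugate entries -/

section Tree

variable {V : Type*}

/-- A relation all of whose points can be reached from `r` contains a tree rooted at `r`. -/
theorem exists_tree (H : V → V → Prop) (r : V) (hH : ∀ v, Relation.ReflTransGen H r v) :
    ∃ (par : V → V) (d : V → ℕ), ∀ v, v ≠ r → H (par v) v ∧ d (par v) < d v := by
  classical
  -- `R n v` says that a walk of length `n` leads from `r` to `v`; the depth `d` will be the
  -- distance from `r`.
  let R : ℕ → V → Prop := fun n => Nat.rec (fun v => v = r) (fun _ P v => ∃ u, P u ∧ H u v) n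
  have hR : ∀ v, ∃ n, R n v := by
    intro v
    induction hH v with
    | refl => exact ⟨0, rfl⟩
    | tail _ h ih =>
      obtain ⟨n, hn⟩ := ih
      exact ⟨n + 1, _, hn, h⟩
  choose d hd hmin using fun v => WellFounded.has_min (wellFounded_lt (α := ℕ)) {n | R n v} (hR v)
  have hpar : ∀ v, ∃ u, v ≠ r → H u v ∧ d u < d v := by
    intro v
    by_cases hv : v = r
    · exact ⟨v, fun h => absurd hv h⟩
    have hspec : R (d v) v := hd v
    rcases hn : d v with _ | n
    · rw [hn] at hspec
      exact absurd hspec hv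
    · rw [hn] at hspec
      obtain ⟨u, hu, huv⟩ := hspec
      exact ⟨u, fun _ => ⟨huv, Nat.lt_succ_of_le (not_lt.mp (hmin u n hu))⟩⟩
  choose par hp using hpar
  exact ⟨par, d, hp⟩

/-- For the 0-1 matrix of a spanning tree, row `i` of `N * adj N = det N` reads `X * adj i r = adj
(par i) r`. Going down to the root reaches `adj r r`, which is monic. -/
theorem exists_adjugate_ne_zero (K : Type*) [Field K] [Fintype V] [DecidableEq V]
    (H : V → V → Prop) (r : V) (hH : ∀ v, Relation.ReflTransGen H r v) :
    ∃ A : Matrix V V K, (∀ i j, ¬ H j i → A i j = 0) ∧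
      ∀ v, A.charmatrix.adjugate v r ≠ 0 := by
  obtain ⟨par, d, hpar⟩ := exists_tree H r hH
  let A : Matrix V V K := Matrix.of fun i j => if i ≠ r ∧ j = par i then 1 else 0
  refine ⟨A, ?_, ?_⟩
  · intro i j hij
    simp only [A, of_apply]
    rw [if_neg]
    rintro ⟨hi, rfl⟩
    exact hij (hpar i hi).1
  have hr : A.charmatrix.adjugate r r ≠ 0 := by
    rw [adjugate_apply_self, ← charmatrix_deleteVertex]
    exact (charpoly_monic _).ne_zero
  have hrow : ∀ i, i ≠ r →
      X * A.charmatrix.adjugate i r = A.charmatrix.adjugate (par i) r := by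
    intro i hi
    have hne : par i ≠ i := fun h => by
      have := (hpar i hi).2
      rw [h] at this
      exact lt_irrefl _ this
    have h1 := congrFun (congrFun (mul_adjugate A.charmatrix) i) r
    rw [Matrix.mul_apply, Finset.sum_eq_add i (par i) hne.symm] at h1
    · rw [charmatrix_apply_eq, charmatrix_apply_ne _ _ _ hne.symm] at h1
      simp [A, hi, hne.symm] at h1
      linear_combination h1
    · intro j _ hj
      rw [charmatrix_apply_ne _ _ _ hj.1.symm]
      simp [A, hj.2]
    · simp
    · simp
  intro v
  induction hn : d v using Nat.strong_induction_on generalizing v with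
  | _ n ih =>
    by_cases hv : v = r
    · rw [hv]; exact hr
    · intro h0
      have := hrow v hv
      rw [h0, mul_zero] at this
      exact ih _ (hn ▸ (hpar v hv).2) (par v) rfl this.symm

end Tree

/-! ### Dimension via the generic matrix -/

section Generic

variable {K : Type*} [Field K]

theorem natCast_le_trdeg_coeffAlgebra_of_map {B B' : Type*} [CommRing B] [Algebra K B]
    [CommRing B'] [Algebra K B'] (φ : B →ₐ[K] B') (f g : B[X]) {N : ℕ}
    (h : (N : Cardinal) ≤ Algebra.trdeg K
      (coeffAlgebra K (f.map (φ : B →+* B')) (g.map (φ : B →+* B')))) :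
    (N : Cardinal) ≤ Algebra.trdeg K (coeffAlgebra K f g) := by
  rw [← map_coeffAlgebra] at h
  let ψ : coeffAlgebra K f g →ₐ[K] (coeffAlgebra K f g).map φ :=
    (φ.comp (coeffAlgebra K f g).val).codRestrict _ fun x => ⟨x, x.2, rfl⟩
  refine natCast_le_trdeg_of_surjective ψ ?_ h
  rintro ⟨_, x, hx, rfl⟩
  exact ⟨⟨x, hx⟩, rfl⟩

theorem deleteVertex_map {V B B' : Type*} (φ : B → B') (r : V) (M : Matrix V V B) :
    deleteVertex r (M.map φ) = (deleteVertex r M).map φ := rfl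

open Classical in
/-- The generic matrix of the parameter space of `G`. -/
noncomputable def genericMatrix (K : Type*) [Field K] {V : Type*} (G : Digraph V) :
    Matrix V V (MvPolynomial (V × V) K) :=
  Matrix.of fun i j => if i = j ∨ G.Adj j i then MvPolynomial.X (i, j) else 0

theorem genericMatrix_map_aeval {V : Type*} (G : Digraph V) {B : Type*} [CommRing B] [Algebra K B]
    (M : Matrix V V B) (hM : ∀ i j, i ≠ j → ¬ G.Adj j i → M i j = 0) :
    (genericMatrix K G).map (MvPolynomial.aeval (R := K) fun p : V × V => M p.1 p.2) = M := by
  ext i j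
  rw [Matrix.map_apply, genericMatrix, of_apply]
  split_ifs with h
  · simp
  · push Not at h
    rw [map_zero, hM i j h.1 h.2]

variable {V : Type*} [Fintype V] [DecidableEq V]

/-- The algebra generated by the coefficients of the characteristic polynomials of a matrix and of
the matrix with the row and the column of `r` deleted. -/
noncomputable abbrev charpolyAlgebra (K : Type*) [Field K] {B : Type*} [CommRing B] [Algebra K B]
    (r : V) (M : Matrix V V B) : Subalgebra K B :=
  coeffAlgebra K M.charpoly (deleteVertex r M).charpoly

/-- The double characteristic polynomial map in the coordinates of the generic matrix. -/
noncomputable def genericCoeff {B : Type*} [CommRing B] (r : V) (M : Matrix V V B) :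
    Fin (Fintype.card V) ⊕ Fin (Fintype.card V - 1) → B :=
  Sum.elim (fun i => M.charpoly.coeff i) (fun i => (deleteVertex r M).charpoly.coeff i)

theorem genericCoeff_map {B B' : Type*} [CommRing B] [CommRing B'] (φ : B →+* B') (r : V)
    (M : Matrix V V B) : genericCoeff r (M.map φ) = φ ∘ genericCoeff r M := by
  ext i
  rcases i with i | i
  · simp [genericCoeff, charpoly_map]
  · simp [genericCoeff, deleteVertex_map, charpoly_map]

theorem coeff_mem_of_monic {B : Type*} [CommRing B] [Nontrivial B] [Algebra K B] {f : B[X]}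
    (hf : f.Monic) (S : Subalgebra K B) (hS : ∀ i < f.natDegree, f.coeff i ∈ S) (i : ℕ) :
    f.coeff i ∈ S := by
  rcases lt_trichotomy i f.natDegree with h | h | h
  · exact hS i h
  · rw [h, hf.coeff_natDegree]
    exact one_mem S
  · rw [coeff_eq_zero_of_natDegree_lt h]
    exact zero_mem S

theorem adjoin_range_genericCoeff {B : Type*} [CommRing B] [Nontrivial B] [Algebra K B] (r : V)
    (M : Matrix V V B) :
    Algebra.adjoin K (Set.range (genericCoeff r M)) = charpolyAlgebra K r M := by
  apply le_antisymm
  · refine Algebra.adjoin_mono ?_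
    rintro _ ⟨i | i, rfl⟩
    · exact Or.inl ⟨i, rfl⟩
    · exact Or.inr ⟨i, rfl⟩
  · refine Algebra.adjoin_le ?_
    rintro _ (⟨i, rfl⟩ | ⟨i, rfl⟩)
    · refine coeff_mem_of_monic (charpoly_monic _) _ (fun j hj => ?_) i
      rw [charpoly_natDegree_eq_dim] at hj
      exact Algebra.subset_adjoin ⟨Sum.inl ⟨j, hj⟩, rfl⟩
    · refine coeff_mem_of_monic (charpoly_monic _) _ (fun j hj => ?_) i
      rw [charpoly_natDegree_eq_dim, Fintype.card_subtype_compl, Fintype.card_subtype_eq] at hj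
      exact Algebra.subset_adjoin ⟨Sum.inr ⟨j, hj⟩, rfl⟩

/-- The points of the parameter space are exactly the specializations of the generic matrix, and
over an infinite field a polynomial vanishing at every point is zero. -/
theorem vanishingIdeal_image_doubleCharpolyMap [Infinite K] (G : Digraph V) (r : V) :
    MvPolynomial.vanishingIdeal K (doubleCharpolyMap r '' parameterSpace K G) =
      RingHom.ker (MvPolynomial.aeval (R := K) (genericCoeff r (genericMatrix K G))) := by
  have heval : ∀ (x : V × V → K) (p : MvPolynomial _ K),
      MvPolynomial.aeval (doubleCharpolyMap r ((genericMatrix K G).map (MvPolynomial.eval x))) p =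
        MvPolynomial.eval x (MvPolynomial.aeval (genericCoeff r (genericMatrix K G)) p) := by
    intro x p
    have h1 : doubleCharpolyMap r ((genericMatrix K G).map (MvPolynomial.eval x)) =
        MvPolynomial.eval x ∘ genericCoeff r (genericMatrix K G) := genericCoeff_map _ r _
    rw [h1]
    exact (MvPolynomial.comp_aeval_apply (genericCoeff r (genericMatrix K G))
      (MvPolynomial.aeval x : MvPolynomial (V × V) K →ₐ[K] K) p).symm
  ext p
  rw [MvPolynomial.mem_vanishingIdeal_iff, RingHom.mem_ker]
  constructor
  · intro h
    apply MvPolynomial.funext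
    intro x
    rw [map_zero]
    have h1 := h _ ⟨(genericMatrix K G).map (MvPolynomial.eval x), ?_, rfl⟩
    · rw [← heval]
      exact h1
    · intro i j hij hadj
      simp [genericMatrix, hij, hadj]
  · rintro h _ ⟨A, hA, rfl⟩
    have h1 := heval (fun p => A p.1 p.2) p
    rw [h, map_zero] at h1
    have h2 := genericMatrix_map_aeval (K := K) G A hA
    rw [← h1]
    congr 2
    exact congrArg _ h2.symm

theorem natCast_le_zariskiDim_iff [Infinite K] (G : Digraph V) (r : V) (N : ℕ) :
    (N : Cardinal) ≤ zariskiDim (doubleCharpolyMap r '' parameterSpace K G) ↔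
      (N : Cardinal) ≤ Algebra.trdeg K (charpolyAlgebra K r (genericMatrix K G)) := by
  let φ := MvPolynomial.aeval (R := K) (genericCoeff r (genericMatrix K G))
  have hr : φ.range = charpolyAlgebra K r (genericMatrix K G) := by
    rw [← adjoin_range_genericCoeff, Algebra.adjoin_range_eq_range_aeval]
  rw [← hr]
  let e := (Ideal.quotientEquivAlgOfEq K (vanishingIdeal_image_doubleCharpolyMap G r)).trans
    (Ideal.quotientKerEquivRange φ)
  exact ⟨natCast_le_trdeg_of_injective e.toAlgHom e.injective,
    natCast_le_trdeg_of_surjective e.toAlgHom e.surjective⟩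

/-- `M` is a specialization of the generic matrix, and specializing cannot raise the transcendence
degree. Lower bounds may therefore use a convenient matrix over any `K`-algebra. -/
theorem natCast_le_zariskiDim_of_matrix [Infinite K] (G : Digraph V) (r : V) {B : Type*}
    [CommRing B] [Algebra K B] (M : Matrix V V B)
    (hM : ∀ i j, i ≠ j → ¬ G.Adj j i → M i j = 0) {N : ℕ}
    (h : (N : Cardinal) ≤ Algebra.trdeg K (charpolyAlgebra K r M)) :
    (N : Cardinal) ≤ zariskiDim (doubleCharpolyMap r '' parameterSpace K G) := by
  rw [natCast_le_zariskiDim_iff]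
  let φ := MvPolynomial.aeval (R := K) fun p : V × V => M p.1 p.2
  apply natCast_le_trdeg_coeffAlgebra_of_map φ
  have h1 : (genericMatrix K G).map (φ : MvPolynomial (V × V) K →+* B) = M :=
    genericMatrix_map_aeval G M hM
  rwa [← charpoly_map, ← charpoly_map, ← deleteVertex_map, h1]

end Generic

/-! ### The upper bound `m + 1` -/

section UpperBound

theorem charpoly_diagonal_conj {F U : Type*} [Field F] [Fintype U] [DecidableEq U]
    (M : Matrix U U F) (d : U → F) (hd : ∀ u, d u ≠ 0) :
    (Matrix.of fun i j => d i * M i j * (d j)⁻¹).charpoly = M.charpoly := by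
  have h1 : (Matrix.of fun i j => d i * M i j * (d j)⁻¹) =
      Matrix.diagonal d * (M * Matrix.diagonal fun j => (d j)⁻¹) := by
    ext i j
    simp [mul_assoc]
  rw [h1, charpoly_mul_comm, Matrix.mul_assoc, Matrix.diagonal_mul_diagonal]
  simp [hd]

theorem charpoly_coeff_mem {K B U : Type*} [Field K] [CommRing B] [Algebra K B] [Fintype U]
    [DecidableEq U] (S : Subalgebra K B) (M : Matrix U U B) (hM : ∀ i j, M i j ∈ S) (n : ℕ) :
    M.charpoly.coeff n ∈ S := by
  let M' : Matrix U U S := Matrix.of fun i j => ⟨M i j, hM i j⟩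
  have h : M'.map (S.val : S →+* B) = M := rfl
  rw [← h, charpoly_map, coeff_map]
  exact (M'.charpoly.coeff n).2

/-- The scaling is determined from the root outwards: each stage corrects the vertices of one depth,
whose parents are already final. -/
theorem exists_tree_scaling {F V : Type*} [Field F] [Fintype V] (r : V) (par : V → V) (dep : V → ℕ)
    (hdep : ∀ v, v ≠ r → dep (par v) < dep v) (x : V → F) (hx : ∀ v, v ≠ r → x v ≠ 0) :
    ∃ d : V → F, (∀ v, d v ≠ 0) ∧ ∀ v, v ≠ r → d v * x v = d (par v) := by
  classical
  have key : ∀ N : ℕ, ∃ d : V → F, (∀ v, d v ≠ 0) ∧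
      ∀ v, v ≠ r → dep v < N → d v * x v = d (par v) := by
    intro N
    induction N with
    | zero => exact ⟨fun _ => 1, by simp, by simp⟩
    | succ N ih =>
      obtain ⟨d, hd, hdN⟩ := ih
      refine ⟨fun v => if v ≠ r ∧ dep v = N then d (par v) / x v else d v, ?_, ?_⟩
      · intro v
        dsimp only
        split_ifs with h
        · exact div_ne_zero (hd _) (hx v h.1)
        · exact hd v
      · intro v hv hvN
        have h1 := hdep v hv
        dsimp only
        rw [if_neg (c := par v ≠ r ∧ dep (par v) = N) (by omega)]
        split_ifs with h
        · exact div_mul_cancel₀ _ (hx v hv)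
        · exact hdN v hv (by have : dep v ≠ N := fun h' => h ⟨hv, h'⟩; omega)
  obtain ⟨d, hd, h⟩ := key (Finset.univ.sup dep + 1)
  exact ⟨d, hd, fun v hv => h v hv (Nat.lt_succ_of_le (Finset.le_sup (Finset.mem_univ v)))⟩

/-- There are `n` diagonal positions and at most `m - (n - 1)` further ones, the tree using `n - 1`
edges. -/
theorem ncard_diagonal_union_le {V : Type*} [Fintype V] (H : V → V → Prop) (r : V) (par : V → V)
    (hpar : ∀ v, v ≠ r → H (par v) v) :
    {p : V × V | p.1 = p.2 ∨ (H p.2 p.1 ∧ ¬ (p.1 ≠ r ∧ p.2 = par p.1))}.ncard ≤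
      {e : V × V | H e.1 e.2}.ncard + 1 := by
  set D : Set (V × V) := Set.range fun v => (v, v)
  set E : Set (V × V) := Prod.swap '' {e : V × V | H e.1 e.2}
  set T : Set (V × V) := (fun v => (v, par v)) '' {v | v ≠ r}
  have hsub : {p : V × V | p.1 = p.2 ∨ (H p.2 p.1 ∧ ¬ (p.1 ≠ r ∧ p.2 = par p.1))} ⊆
      D ∪ (E \ T) := by
    rintro ⟨i, j⟩ (h | ⟨h, h'⟩)
    · exact Or.inl ⟨i, by simpa using h⟩
    · refine Or.inr ⟨⟨(j, i), h, rfl⟩, ?_⟩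
      rintro ⟨v, hv, hvp⟩
      obtain ⟨rfl, rfl⟩ := Prod.mk.inj hvp
      exact h' ⟨hv, rfl⟩
  have hD : D.ncard = Fintype.card V := by
    rw [← Nat.card_eq_fintype_card, Set.ncard_range_of_injective]
    intro a b h
    exact (Prod.mk.inj h).1
  have hE : E.ncard = {e : V × V | H e.1 e.2}.ncard :=
    Set.ncard_image_of_injective _ Prod.swap_injective
  have hT : T.ncard = Fintype.card V - 1 := by
    rw [Set.ncard_image_of_injective _ fun a b h => (Prod.mk.inj h).1]
    have : {v : V | v ≠ r} = {r}ᶜ := rfl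
    rw [this, Set.ncard_compl, Set.ncard_singleton, Nat.card_eq_fintype_card]
  have hTE : T ⊆ E := by
    rintro _ ⟨v, hv, rfl⟩
    exact ⟨(par v, v), hpar v hv, rfl⟩
  have h1 := Set.ncard_le_ncard hsub
  have h2 := Set.ncard_union_le D (E \ T)
  have h3 := Set.ncard_sdiff_add_ncard_of_subset hTE
  have h4 : 0 < Fintype.card V := Fintype.card_pos_iff.mpr ⟨r⟩
  omega

variable {K : Type*} [Field K] {V : Type*} [Fintype V] [DecidableEq V]

/-- The dimension of the image of the double characteristic polynomial map of a strongly connected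
graph with `m` edges is at most `m + 1`. -/
theorem le_of_natCast_le_zariskiDim [Infinite K] (G : Digraph V) (hG : StronglyConnected G)
    (r : V) {N : ℕ}
    (hN : (N : Cardinal) ≤ zariskiDim (doubleCharpolyMap r '' parameterSpace K G)) :
    N ≤ numEdges G + 1 := by
  rw [natCast_le_zariskiDim_iff] at hN
  obtain ⟨par, dep, htree⟩ := exists_tree G.Adj r (hG r)
  let F := FractionRing (MvPolynomial (V × V) K)
  let ι : MvPolynomial (V × V) K →ₐ[K] F := IsScalarTower.toAlgHom K _ F
  have hι : Function.Injective ι := IsFractionRing.injective (MvPolynomial (V × V) K) F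
  let M := (genericMatrix K G).map ι
  have hM : ∀ i j, i ≠ j → ¬ G.Adj j i → M i j = 0 := by
    intro i j hij hadj
    simp [M, genericMatrix, hij, hadj]
  obtain ⟨d, hd, hdpar⟩ := exists_tree_scaling r par dep (fun v hv => (htree v hv).2)
    (fun v => M v (par v)) (fun v hv => by
      simp only [M, Matrix.map_apply, genericMatrix, of_apply, (htree v hv).1, or_true, if_true]
      rw [map_ne_zero_iff _ hι]
      exact MvPolynomial.X_ne_zero _)
  -- By the choice of `d`, the conjugate has entry 1 at each tree position `(v, par v)`; only the
  -- positions in `Z` remain free.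
  let M' : Matrix V V F := Matrix.of fun i j => d i * M i j * (d j)⁻¹
  let Z : Set (V × V) := {p | p.1 = p.2 ∨ (G.Adj p.2 p.1 ∧ ¬ (p.1 ≠ r ∧ p.2 = par p.1))}
  let φ : MvPolynomial Z K →ₐ[K] F := MvPolynomial.aeval fun z => M' z.1.1 z.1.2
  have hM' : ∀ i j, M' i j ∈ φ.range := by
    intro i j
    by_cases hz : (i, j) ∈ Z
    · exact ⟨MvPolynomial.X ⟨(i, j), hz⟩, by simp [φ]⟩
    · simp only [Z, Set.mem_ofPred_eq, not_or, not_and] at hz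
      by_cases hadj : G.Adj j i
      · obtain ⟨hi, rfl⟩ : i ≠ r ∧ j = par i := by simpa using hz.2 hadj
        have : M' i (par i) = 1 := by
          simp only [M', of_apply]
          rw [hdpar i hi, mul_inv_cancel₀ (hd _)]
        rw [this]
        exact one_mem _
      · have : M' i j = 0 := by simp [M', hM i j hz.1 hadj]
        rw [this]
        exact zero_mem _
  have hle : (charpolyAlgebra K r (genericMatrix K G)).map ι ≤ φ.range := by
    rw [map_coeffAlgebra, ← charpoly_map, ← charpoly_map, ← deleteVertex_map]
    refine Algebra.adjoin_le ?_
    rintro _ (⟨n, rfl⟩ | ⟨n, rfl⟩)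
    · have := charpoly_coeff_mem φ.range M' hM' n
      rwa [charpoly_diagonal_conj M d hd] at this
    · have := charpoly_coeff_mem φ.range (deleteVertex r M') (fun i j => hM' i j) n
      have h2 := charpoly_diagonal_conj (deleteVertex r M) (fun i => d i) (fun i => hd i)
      exact h2 ▸ this
  have h1 : (N : Cardinal) ≤ Algebra.trdeg K φ.range := by
    refine natCast_le_trdeg_of_injective ((ι.comp (Subalgebra.val _)).codRestrict φ.range
      fun x => hle ⟨x, x.2, rfl⟩) (fun a b hab => Subtype.ext (hι ?_)) hN
    exact congrArg Subtype.val hab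
  have h2 := natCast_le_trdeg_of_surjective φ.rangeRestrict φ.rangeRestrict_surjective h1
  rw [MvPolynomial.trdeg_of_isDomain] at h2
  have h3 : N ≤ Z.ncard := by
    have : Cardinal.mk Z = Z.ncard := by
      rw [Set.cast_ncard (Set.toFinite Z)]
    rw [this] at h2
    simpa using h2
  exact h3.trans (ncard_diagonal_union_le G.Adj r par fun v hv => (htree v hv).1)

theorem hasExpectedDimension_iff [Infinite K] (G : Digraph V) (hG : StronglyConnected G) (r : V) :
    HasExpectedDimension K G r ↔ ((numEdges G + 1 : ℕ) : Cardinal) ≤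
      zariskiDim (doubleCharpolyMap r '' parameterSpace K G) := by
  refine ⟨fun h => h.ge, fun h => le_antisymm ?_ h⟩
  by_contra hlt
  rw [not_le, ← Order.succ_le_iff, Cardinal.succ_natCast, ← Nat.cast_succ] at hlt
  have := le_of_natCast_le_zariskiDim G hG r hlt
  omega

end UpperBound

/-! ### Adding a path to the graph -/

section AddPath

variable {V : Type*}

theorem stronglyConnected_addPath (G : Digraph V) (hG : StronglyConnected G) (r : V) {s : ℕ}
    (k l : V) : StronglyConnected (addPath G s k l) := by
  have hinl : ∀ u v, Relation.ReflTransGen (addPath G s k l).Adj (.inl u) (.inl v) := fun u v =>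
    Relation.ReflTransGen.lift (r := G.Adj) Sum.inl (fun _ _ h => h) _ _ (hG u v)
  have hto : ∀ n (hn : n < s), Relation.ReflTransGen (addPath G s k l).Adj (.inl r)
      (.inr ⟨n, hn⟩) := by
    intro n
    induction n with
    | zero => exact fun hn => (hinl r k).tail ⟨rfl, rfl⟩
    | succ n ih => exact fun hn => (ih (by omega)).tail rfl
  have hfrom : ∀ t n (hn : n < s), n + 1 + t = s →
      Relation.ReflTransGen (addPath G s k l).Adj (.inr ⟨n, hn⟩) (.inl r) := by
    intro t
    induction t with
    | zero =>
      exact fun n hn h =>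
        Relation.ReflTransGen.head
        (show (addPath G s k l).Adj (.inr ⟨n, hn⟩) (.inl l) from ⟨h, rfl⟩) (hinl l r)
    | succ t ih =>
      intro n hn h
      exact Relation.ReflTransGen.head (show (addPath G s k l).Adj (.inr ⟨n, hn⟩)
        (.inr ⟨n + 1, by omega⟩) from rfl) (ih (n + 1) (by omega) (by omega))
  intro u v
  refine Relation.ReflTransGen.trans (b := .inl r) ?_ ?_
  · rcases u with u | ⟨n, hn⟩
    · exact hinl u r
    · exact hfrom (s - (n + 1)) n hn (by omega)
  · rcases v with v | ⟨n, hn⟩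
    · exact hinl r v
    · exact hto n hn

theorem numEdges_addPath [Finite V] (G : Digraph V) {s : ℕ} (hs : 1 ≤ s) (k l : V) :
    numEdges (addPath G s k l) = numEdges G + (s + 1) := by
  -- The `s + 1` new edges are indexed by their sources, which are distinct even when `k = l`.
  let src : Fin (s + 1) → V ⊕ Fin s := Fin.cons (.inl k) .inr
  let tgt : Fin (s + 1) → V ⊕ Fin s := fun t => if h : (t : ℕ) < s then .inr ⟨t, h⟩ else .inl l
  have hsrc : Function.Injective src :=
    Fin.cons_injective_iff.mpr ⟨by simp, Sum.inr_injective⟩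
  have hset : {e : (V ⊕ Fin s) × (V ⊕ Fin s) | (addPath G s k l).Adj e.1 e.2} =
      (Prod.map Sum.inl Sum.inl '' {e : V × V | G.Adj e.1 e.2}) ∪
        Set.range fun t => (src t, tgt t) := by
    ext ⟨x, y⟩
    constructor
    · intro h
      rcases x with u | ⟨i, hi⟩ <;> rcases y with v | ⟨j, hj⟩
      · exact Or.inl ⟨(u, v), h, rfl⟩
      · obtain ⟨rfl, h0⟩ : u = k ∧ j = 0 := h
        subst h0
        exact Or.inr ⟨0, by simp [src, tgt, hj]⟩
      · obtain ⟨h0, rfl⟩ : i + 1 = s ∧ v = l := h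
        exact Or.inr ⟨Fin.succ ⟨i, hi⟩, Prod.ext rfl (by simp [tgt, h0])⟩
      · have h : j = i + 1 := h
        subst h
        exact Or.inr ⟨Fin.succ ⟨i, hi⟩, Prod.ext rfl (by simp [tgt, hj])⟩
    · rintro (⟨⟨u, v⟩, h, h'⟩ | ⟨t, h'⟩)
      · obtain ⟨rfl, rfl⟩ := Prod.mk.inj h'
        exact h
      · obtain ⟨rfl, rfl⟩ := Prod.mk.inj h'
        change addPathAdj G s k l (src t) (tgt t)
        refine Fin.cases ?_ (fun t => ?_) t
        · simp [src, tgt, addPathAdj, show 0 < s from hs]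
        · by_cases ht : (t : ℕ) + 1 < s
          · simp [src, tgt, addPathAdj, ht]
          · have := t.2
            have : (t : ℕ) + 1 = s := by omega
            simp [src, tgt, addPathAdj, this]
  have hdisj : Disjoint (Prod.map Sum.inl Sum.inl '' {e : V × V | G.Adj e.1 e.2})
      (Set.range fun t => (src t, tgt t)) := by
    rw [Set.disjoint_left]
    rintro _ ⟨⟨u, v⟩, h, rfl⟩ ⟨t, ht⟩
    obtain ⟨h1, h2⟩ := Prod.mk.inj ht
    revert h1 h2
    refine Fin.cases ?_ (fun t => ?_) t
    · simp [tgt, show 0 < s from hs]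
    · simp [src]
  rw [numEdges, hset, Set.ncard_union_eq hdisj (Set.toFinite _) (Set.toFinite _),
    Set.ncard_image_of_injective _ (Sum.inl_injective.prodMap Sum.inl_injective),
    Set.ncard_range_of_injective fun a b h => hsrc (Prod.mk.inj h).1, Nat.card_fin]
  rfl

theorem charpoly_deleteVertex_attachPath [Fintype V] [DecidableEq V] {B : Type*} [CommRing B]
    {s : ℕ} (r : V) (A : Matrix V V B) (a b : V → B) (c : B) (z : Fin s → B) :
    (deleteVertex (Sum.inl r) (attachPath A a b c z)).charpoly =
      (attachPath (deleteVertex r A) (a ∘ Subtype.val) (b ∘ Subtype.val) c z).charpoly := by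
  let e : {v : V // v ≠ r} ⊕ Fin s ≃ {w : V ⊕ Fin s // w ≠ Sum.inl r} :=
    { toFun := Sum.elim (fun v => ⟨.inl v, fun h => v.2 (Sum.inl_injective h)⟩)
        (fun i => ⟨.inr i, Sum.inr_ne_inl⟩)
      invFun := fun w => match w with
        | ⟨.inl v, h⟩ => .inl ⟨v, fun h' => h (congrArg _ h')⟩
        | ⟨.inr i, _⟩ => .inr i
      left_inv := by rintro (v | i) <;> rfl
      right_inv := by rintro ⟨v | i, h⟩ <;> rfl }
  rw [← charpoly_reindex e.symm]
  congr 1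
  ext1 i j
  rcases i with i | i <;> rcases j with j | j <;> rfl

theorem adjugate_charmatrix_map {R S U : Type*} [CommRing R] [CommRing S] [Fintype U]
    [DecidableEq U] (φ : R →+* S) (A : Matrix U U R) (i j : U) :
    (A.map φ).charmatrix.adjugate i j = (A.charmatrix.adjugate i j).map φ := by
  rw [charmatrix_map, ← coe_mapRingHom, ← RingHom.mapMatrix_apply, ← RingHom.map_adjugate]
  rfl

/-- The characteristic polynomial of a matrix with a generic path attached to it. -/
theorem charpoly_attachPath_generic {R U : Type*} [CommRing R] [IsDomain R] [Fintype U]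
    [DecidableEq U] {s : ℕ} (hs : 1 ≤ s) (A : Matrix U U R) (a b : U → R)
    (κ : R →+* (MvPolynomial (Fin s) R)[X]) (hκ : κ = C.comp MvPolynomial.C) :
    (attachPath (A.map κ) (fun u => X * κ (a u)) (fun u => κ (b u)) 1
      (fun i => C (MvPolynomial.X i))).charpoly =
      ((∏ i, (X - C (MvPolynomial.X i))) * A.charpoly.map MvPolynomial.C).map C -
        C X * (((C ∘ b) ⬝ᵥ (A.charmatrix.adjugate *ᵥ (C ∘ a))).map MvPolynomial.C).map C := by
  rw [charpoly_attachPath hs, charpoly_map]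
  congr 1
  · simp only [Polynomial.map_mul, Polynomial.map_prod, Polynomial.map_sub, Polynomial.map_X,
      Polynomial.map_C, Polynomial.map_map, hκ]
  · have h1 : (C ∘ fun u => X * κ (a u)) = (C X : (MvPolynomial (Fin s) R)[X][X]) •
        (mapRingHom κ ∘ C ∘ a) := by
      ext1 u
      simp
    have h2 : (C ∘ fun u => κ (b u)) = mapRingHom κ ∘ C ∘ b := by
      ext1 u
      simp
    have h3 : (A.map κ).charmatrix.adjugate *ᵥ (mapRingHom κ ∘ C ∘ a) =
        mapRingHom κ ∘ (A.charmatrix.adjugate *ᵥ (C ∘ a)) := by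
      ext1 i
      have h4 : (A.map κ).charmatrix.adjugate = A.charmatrix.adjugate.map (mapRingHom κ) := by
        ext1 i j
        exact adjugate_charmatrix_map κ A i j
      rw [Function.comp_apply (f := mapRingHom κ), RingHom.map_mulVec, h4]
    rw [h1, h2, mulVec_smul, dotProduct_smul, h3, ← RingHom.map_dotProduct, smul_eq_mul,
      Polynomial.map_map, ← hκ, coe_mapRingHom]

theorem adjugate_charmatrix_genericMatrix_ne_zero {K : Type*} [Field K] [Fintype V]
    [DecidableEq V] (G : Digraph V) (A : Matrix V V K) (hA : ∀ i j, ¬ G.Adj j i → A i j = 0)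
    (i j : V) (h : A.charmatrix.adjugate i j ≠ 0) :
    (genericMatrix K G).charmatrix.adjugate i j ≠ 0 := by
  intro h0
  apply h
  rw [← genericMatrix_map_aeval (K := K) G A fun i j _ => hA i j]
  have := adjugate_charmatrix_map ((MvPolynomial.aeval (R := K) fun p : V × V => A p.1 p.2 :
    MvPolynomial (V × V) K →ₐ[K] K) : MvPolynomial (V × V) K →+* K) (genericMatrix K G) i j
  rw [h0, Polynomial.map_zero] at this
  exact this

theorem natCast_le_zariskiDim_addPath {K : Type*} [Field K] [Infinite K] [Fintype V]
    [DecidableEq V] (G : Digraph V) (hG : StronglyConnected G) (r : V) {s N : ℕ} (hs : 1 ≤ s)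
    (k l : V) (hN : (N : Cardinal) ≤ zariskiDim (doubleCharpolyMap r '' parameterSpace K G)) :
    ((N + s + 1 : ℕ) : Cardinal) ≤ zariskiDim
      (doubleCharpolyMap (Sum.inl r) '' parameterSpace K (addPath G s k l)) := by
  rw [natCast_le_zariskiDim_iff] at hN
  let R := MvPolynomial (V × V) K
  let A := genericMatrix K G
  let a : V → R := Pi.single l 1
  let b : V → R := Pi.single k 1
  let κ : R →+* (MvPolynomial (Fin s) R)[X] := C.comp MvPolynomial.C
  -- Only the product of the path weights matters, so the edge into `l` carries the variable and the
  -- other path edges have weight 1.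
  let M := attachPath (A.map κ) (fun u => X * κ (a u)) (fun u => κ (b u)) 1
    (fun i : Fin s => C (MvPolynomial.X i))
  have hM : ∀ i j, i ≠ j → ¬ (addPath G s k l).Adj j i → M i j = 0 := by
    rintro (u | i) (v | j) hij hadj
    · have h1 : ¬ G.Adj v u := hadj
      have h2 : u ≠ v := fun h => hij (congrArg _ h)
      simp [M, attachPath, A, genericMatrix, h1, h2]
    · have h1 : ¬ ((j : ℕ) + 1 = s ∧ u = l) := hadj
      simp only [M, attachPath, fromBlocks_apply₁₂, of_apply]
      split_ifs with h
      · have : u ≠ l := fun h' => h1 ⟨h, h'⟩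
        simp [a, this]
      · rfl
    · have h1 : ¬ (v = k ∧ (i : ℕ) = 0) := hadj
      simp only [M, attachPath, fromBlocks_apply₂₁, of_apply]
      split_ifs with h
      · have : v ≠ k := fun h' => h1 ⟨h', h⟩
        simp [b, this]
      · rfl
    · have h1 : ¬ ((i : ℕ) = (j : ℕ) + 1) := hadj
      have h2 : i ≠ j := fun h => hij (congrArg _ h)
      simp [M, attachPath, pathMatrix, h1, h2]
  apply natCast_le_zariskiDim_of_matrix _ _ M hM
  have hdet : (deleteVertex r A.charmatrix).det ≠ 0 := by
    rw [← charmatrix_deleteVertex]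
    exact (charpoly_monic (deleteVertex r A)).ne_zero
  have hid := det_mul_adjugate_deleteVertex A.charmatrix r hdet (C ∘ a) (C ∘ b)
  have hF := charpoly_attachPath_generic hs A a b κ rfl
  have hF' := (charpoly_deleteVertex_attachPath r (A.map κ) (fun u => X * κ (a u))
    (fun u => κ (b u)) 1 (fun i : Fin s => C (MvPolynomial.X i))).trans
      (charpoly_attachPath_generic hs (deleteVertex r A) (a ∘ Subtype.val) (b ∘ Subtype.val) κ rfl)
  have hg : A.charmatrix.det = A.charpoly := rfl
  have hg' : (deleteVertex r A.charmatrix).det = (deleteVertex r A).charpoly := by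
    rw [← charmatrix_deleteVertex]
    rfl
  rw [hg, hg', ← charmatrix_deleteVertex] at hid
  refine natCast_le_trdeg_coeffAlgebra_path (K := K) (charpoly_monic A)
    (charpoly_monic (deleteVertex r A)) (ne_of_eq_of_ne hid (mul_ne_zero ?_ ?_)) hs hN _ rfl
    M.charpoly (deleteVertex (Sum.inl r) M).charpoly hF hF'
  · have ha : C ∘ a = Pi.single l 1 := by
      ext1 u
      simp [a, Pi.single_apply, apply_ite C]
    rw [ha, mulVec_single_one]
    -- The entry at `(r, l)` calls for paths from `l` to `r`: a tree of the reversed graph,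
    -- transposed.
    obtain ⟨A₀, hA₀, h⟩ := exists_adjugate_ne_zero K (fun u v => G.Adj v u) r
      (fun v => Relation.reflTransGen_swap.mp (hG v r))
    refine adjugate_charmatrix_genericMatrix_ne_zero G A₀ᵀ (fun i j hij => hA₀ j i hij) r l ?_
    rw [charmatrix_transpose, ← adjugate_transpose]
    exact h l
  · have hb : C ∘ b = Pi.single k 1 := by
      ext1 u
      simp [b, Pi.single_apply, apply_ite C]
    rw [hb, single_one_vecMul]
    obtain ⟨A₀, hA₀, h⟩ := exists_adjugate_ne_zero K G.Adj r (hG r)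
    exact adjugate_charmatrix_genericMatrix_ne_zero G A₀ hA₀ k r (h k)

end AddPath

end CompartmentModel

theorem proposition4p9 {𝕜 : Type*} [RCLike 𝕜] {V : Type*} [Fintype V] [DecidableEq V]
    (G : Digraph V) (hloop : ∀ v : V, ¬ G.Adj v v)
    (hconn : CompartmentModel.StronglyConnected G)
    (r : V) (hG : CompartmentModel.HasExpectedDimension 𝕜 G r)
    (s : ℕ) (hs : 1 ≤ s) (k l : V) :
    CompartmentModel.HasExpectedDimension 𝕜 (CompartmentModel.addPath G s k l) (Sum.inl r) := by
  -- Of the real or complex field, only its infinitude enters.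
  have : Infinite 𝕜 := Infinite.of_injective ((↑) : ℕ → 𝕜) Nat.cast_injective
  rw [CompartmentModel.hasExpectedDimension_iff _
    (CompartmentModel.stronglyConnected_addPath G hconn r k l),
    CompartmentModel.numEdges_addPath G hs k l]
  have h := CompartmentModel.natCast_le_zariskiDim_addPath G hconn r hs k l hG.ge
  have e : CompartmentModel.numEdges G + (s + 1) + 1 =
      CompartmentModel.numEdges G + 1 + s + 1 := by omega
  rw [e]
  exact h
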